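/- For a square matrix $M$ with rows and columns indexed by a finite set $V$ and for $I\subseteq V$, let $M(I|I)$ be the principal submatrix obtained from $M$ by deleting the rows and columns with index in $I$, and let $\overline I=V\setminus I$; the permanent and the determinant of the empty matrix are $1$. For an $n\times n$ matrix $A=(a_{ij})_{i,j\in V}$, $n=|V|$, and parameters $\lambda=(\lambda_i)_{i\in V}$ in a field $K$ of characteristic $0$, let $A^{(\lambda)}$ be the matrix with diagonal entries $\lambda_i$ and off-diagonal entries $a_{ij}$ ($i\neq j$), and put $$A^{(\lambda)}_l=\sum_{I\subseteq V,\ |I|=l}\operatorname{per}A^{(\lambda)}(I|I)\,\det A^{(\lambda)}(\overline I|\overline I).$$ (Thus the determinant is that of the principal submatrix with index set $I$, and the permanent is that of the complementary principal submatrix.) (a) Let $G$ be a finite simple graph with $n\ge 3$ vertices and adjacency matrix $A$, and let $H_c$ be the number of its Hamiltonian cycles (counted as subgraphs). Then, for every choice of the parameters $\lambda_i\in K$, $$H_c=\frac1{2n}\sum_{l=1}^n l(-1)^{l-1}A^{(\lambda)}_l .$$ (b) Let $D$ be a finite digraph (possibly with loops) with $n\ge2$ vertices and $0$-$1$ adjacency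 matrix $A$. Then, for every choice of the $\lambda_i\in K$, the number of directed Hamiltonian cycles of $D$ is $$\frac1{n}\sum_{l=1}^n l(-1)^{l-1}A^{(\lambda)}_l .$$ (c) For the complete graph $K_n$, $n\ge 3$, and $\lambda_i=1$ for all $i$, one has $A^{(1)}_1=n!$ and $A^{(1)}_l=0$ for $2\le l\le n$; moreover $H_c=\frac12(n-1)!$. (d) For the complete bipartite graph $K_{n_1n_2}$ with $n=n_1+n_2\ge3$ and $\lambda_i=0$ for all $i$, one has $A^{(0)}_2=-n_1!\,n_2!\,\delta_{n_1n_2}$ and $A^{(0)}_l=0$ for $1\le l\le n$, $l\ne2$; moreover $$H_c=\frac{1}{n_1+n_2}\,n_1!\,n_2!\,\delta_{n_1n_2}.$$ -/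

import Mathlib

universe u v

namespace HamiltonianEnumeration

/-- The number of Hamiltonian cycles of a finite simple graph. A Hamiltonian cycle is regarded as
a subgraph of `G` (so neither the starting vertex nor the orientation matters): it is the subgraph
traced out by a closed walk which is a cycle through all the vertices. -/
noncomputable def hamCycleCount {V : Type v} [DecidableEq V] (G : SimpleGraph V) : ℕ :=
  {H : G.Subgraph | ∃ (a : V) (p : G.Walk a a), p.IsHamiltonianCycle ∧ p.toSubgraph = H}.ncard

/-- The number of directed Hamiltonian cycles of a finite digraph. A directed Hamiltonian cycle is
given by its successor map, a permutation `σ` of the vertices which consists of one cycle through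
all the vertices and is such that there is an arc from `i` to `σ i` for every vertex `i`. -/
noncomputable def diHamCycleCount {V : Type v} [Fintype V] [DecidableEq V] (D : Digraph V) : ℕ :=
  {σ : Equiv.Perm V | σ.IsCycle ∧ σ.support = Finset.univ ∧ ∀ i, D.Adj i (σ i)}.ncard

/-- The 0-1 adjacency matrix of a digraph. -/
def diAdjMatrix (K : Type u) [Zero K] [One K] {V : Type v} (D : Digraph V) [DecidableRel D.Adj] :
    Matrix V V K :=
  Matrix.of fun i j => if D.Adj i j then 1 else 0

/-- The matrix `B^(lam)`: the diagonal entries of `B` are replaced by the parameters `lam i`. -/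
def paramMatrix {K : Type u} {V : Type v} [DecidableEq V] (B : Matrix V V K) (lam : V → K) :
    Matrix V V K :=
  Matrix.of fun i j => if i = j then lam i else B i j

/-- The principal submatrix `M(I|I)` obtained from `M` by deleting the rows and columns whose
index lies in `I`. -/
def deletePrincipal {K : Type u} {V : Type v} (M : Matrix V V K) (I : Finset V) :
    Matrix {i : V // i ∉ I} {i : V // i ∉ I} K :=
  M.submatrix Subtype.val Subtype.val

/-- The coefficient
`A_l = ∑_{I ⊆ V, |I| = l} per M(I|I) * det M(Iᶜ|Iᶜ)` of a square matrix `M`, where `M(J|J)` is `M`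
with the rows and columns in `J` deleted. (Empty permanents and determinants are `1`.) -/
def perDetCoeff {K : Type u} [CommRing K] {V : Type v} [Fintype V] [DecidableEq V]
    (M : Matrix V V K) (l : ℕ) : K :=
  ∑ I ∈ (Finset.univ : Finset V).powersetCard l,
    (deletePrincipal M I).permanent * (deletePrincipal M Iᶜ).det

end HamiltonianEnumeration

/-! Expanding a determinant on `I` and a permanent off `I` together gives a sum over the
permutations `σ` that preserve `I`, weighted by the sign of `σ` restricted to `I`
(`permanent_mul_det_eq_sum`). So the alternating sum of the coefficients assigns to each `σ` the
number `-∑ |I| (-1)^|I| sign(σ|I)`, taken over the unions `I` of cycles of `σ`. Here `(-1)^|I|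
sign(σ|I)` is `-1` to the number of cycles in `I`. Writing `|I|` as a sum over its points `v` and
toggling a cycle that avoids `v`, everything cancels unless `σ` is a single cycle through all of
`V`; then only `I = V` remains and the weight is `n` (`sum_card_mul_signOn`).

A full cycle on at least two points has no fixed point, so the diagonal parameters never enter. The
surviving permutations are the directed Hamiltonian cycles; in a graph with at least three vertices
each Hamiltonian cycle arises from exactly two of them, `σ` and `σ⁻¹` (`ncard_cyclePerms_eq`).

For the complete and complete bipartite graphs the parameters are chosen so that many rows coincide.
The determinants then vanish except on single vertices, respectively on pairs with one vertex from
each side, and one coefficient gives the count. -/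

namespace HamiltonianEnumeration

open Equiv Equiv.Perm Finset

/-! ### Signed sums over the invariant sets of a permutation. -/

section InvariantSets

variable {V : Type v} [Fintype V] [DecidableEq V]

/-- The sign of the restriction of `σ` to `I` if `I` is invariant under `σ`, and `0` otherwise. -/
def signOn (σ : Perm V) (I : Finset V) : ℤ :=
  if h : ∀ x, σ x ∈ I ↔ x ∈ I then (sign (σ.subtypePerm h) : ℤ) else 0

theorem signOn_of_invariant {σ : Perm V} {I : Finset V} (h : ∀ x, σ x ∈ I ↔ x ∈ I) :
    signOn σ I = (sign (σ.subtypePerm h) : ℤ) :=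
  dif_pos h

theorem signOn_of_not_invariant {σ : Perm V} {I : Finset V} (h : ¬ ∀ x, σ x ∈ I ↔ x ∈ I) :
    signOn σ I = 0 :=
  dif_neg h

theorem signOn_univ (σ : Perm V) : signOn σ univ = (sign σ : ℤ) := by
  rw [signOn_of_invariant (by simp), ← sign_ofSubtype, ofSubtype_subtypePerm _ (by simp)]

open Classical in
/-- The set of points on the cycle of `σ` through `w`. -/
noncomputable def orbitFinset (σ : Perm V) (w : V) : Finset V :=
  univ.filter (σ.SameCycle w)

theorem mem_orbitFinset {σ : Perm V} {w x : V} : x ∈ orbitFinset σ w ↔ σ.SameCycle w x := by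
  simp [orbitFinset]

theorem apply_mem_orbitFinset (σ : Perm V) (w x : V) :
    σ x ∈ orbitFinset σ w ↔ x ∈ orbitFinset σ w := by
  simp [mem_orbitFinset, sameCycle_apply_right]

omit [DecidableEq V] in
theorem sameCycle_mem_iff {σ : Perm V} {I : Finset V} (h : ∀ x, σ x ∈ I ↔ x ∈ I) {x y : V}
    (hxy : σ.SameCycle x y) : x ∈ I ↔ y ∈ I := by
  obtain ⟨k, rfl⟩ := hxy.exists_nat_pow_eq
  induction k with
  | zero => simp
  | succ k ih => rw [pow_succ', Perm.mul_apply, h]; exact ih ⟨k, by simp⟩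

-- The orbit of a fixed point has one element, so the formula also covers the trivial cycle, whose
-- sign is `1`.
open Classical in
theorem sign_cycleOf_eq (σ : Perm V) (w : V) :
    (sign (σ.cycleOf w) : ℤ) = -(-1) ^ #(orbitFinset σ w) := by
  by_cases hw : σ w = w
  · have : orbitFinset σ w = {w} := by
      ext y
      rw [mem_orbitFinset, mem_singleton]
      exact ⟨fun h => (h.eq_of_left hw).symm, fun h => h ▸ SameCycle.refl _ _⟩
    rw [this, (cycleOf_eq_one_iff σ).2 hw]
    simp
  · have : orbitFinset σ w = (σ.cycleOf w).support := by
      ext y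
      rw [mem_orbitFinset, mem_support_cycleOf_iff' hw]
    rw [this, (isCycle_cycleOf σ hw).sign]
    simp

/-- A new cycle of length `c` contributes `(-1)^(c-1)` to the sign and `(-1)^c` to the parity of the
size, hence `-1` in total. -/
theorem signOn_union_orbit {σ : Perm V} {I : Finset V} (h : ∀ x, σ x ∈ I ↔ x ∈ I) {w : V}
    (hw : w ∉ I) :
    (-1) ^ #(I ∪ orbitFinset σ w) * signOn σ (I ∪ orbitFinset σ w) =
      -((-1) ^ #I * signOn σ I) := by
  classical
  have hdisj : Disjoint I (orbitFinset σ w) := by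
    rw [Finset.disjoint_left]
    intro x hx hx'
    exact hw ((sameCycle_mem_iff h (mem_orbitFinset.1 hx')).2 hx)
  have h' : ∀ x, σ x ∈ I ∪ orbitFinset σ w ↔ x ∈ I ∪ orbitFinset σ w := by
    intro x
    rw [mem_union, mem_union, h, apply_mem_orbitFinset]
  have key : ofSubtype (σ.subtypePerm h') = ofSubtype (σ.subtypePerm h) * σ.cycleOf w := by
    ext x
    rw [Perm.mul_apply]
    by_cases hx : σ.SameCycle w x
    · have hxC := mem_orbitFinset.2 hx
      rw [ofSubtype_apply_of_mem _ (by simp [hxC]), hx.cycleOf_apply,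
        ofSubtype_apply_of_not_mem]
      · simp
      · rw [h]
        exact Finset.disjoint_right.1 hdisj hxC
    · rw [cycleOf_apply_of_not_sameCycle hx]
      by_cases hxI : x ∈ I
      · rw [ofSubtype_apply_of_mem _ hxI, ofSubtype_apply_of_mem _ (by simp [hxI])]
        simp
      · rw [ofSubtype_apply_of_not_mem _ hxI,
          ofSubtype_apply_of_not_mem _ (by simp [hxI, mem_orbitFinset, hx])]
  have hs := congrArg (fun τ => (sign τ : ℤ)) key
  simp only [sign_ofSubtype, map_mul, Units.val_mul, sign_cycleOf_eq] at hs
  rw [signOn_of_invariant h', signOn_of_invariant h, hs, card_union_of_disjoint hdisj, pow_add]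
  have h1 : ((-1 : ℤ) ^ #(orbitFinset σ w)) * (-1) ^ #(orbitFinset σ w) = 1 := by
    rw [← mul_pow]; simp
  linear_combination (-(-1 : ℤ) ^ #I * (sign (σ.subtypePerm h) : ℤ)) * h1

/-- Toggling the orbit of `w` is an involution that reverses the sign of each term and, since that
orbit misses `v`, keeps `v` in the set. -/
theorem sum_signOn_eq_zero {σ : Perm V} {v w : V} (hvw : ¬ σ.SameCycle v w) :
    ∑ I : Finset V with v ∈ I, (-1) ^ #I * signOn σ I = 0 := by
  classical
  have hvC : v ∉ orbitFinset σ w := fun h => hvw (mem_orbitFinset.1 h).symm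
  have hwC : w ∈ orbitFinset σ w := mem_orbitFinset.2 (SameCycle.refl _ _)
  have hinv : ∀ I : Finset V, (∀ x, σ x ∈ I ↔ x ∈ I) →
      ∀ x, σ x ∈ symmDiff I (orbitFinset σ w) ↔ x ∈ symmDiff I (orbitFinset σ w) := by
    intro I h x
    rw [mem_symmDiff, mem_symmDiff, h, apply_mem_orbitFinset]
  have hout : ∀ I : Finset V, (∀ x, σ x ∈ I ↔ x ∈ I) → w ∉ I →
      symmDiff I (orbitFinset σ w) = I ∪ orbitFinset σ w := by
    intro I h hw
    rw [Disjoint.symmDiff_eq_sup, sup_eq_union]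
    rw [Finset.disjoint_left]
    intro x hx hx'
    exact hw ((sameCycle_mem_iff h (mem_orbitFinset.1 hx')).2 hx)
  refine Finset.sum_involution (fun I _ => symmDiff I (orbitFinset σ w)) ?_ ?_ ?_ ?_
  · intro I _
    by_cases h : ∀ x, σ x ∈ I ↔ x ∈ I
    · by_cases hw : w ∈ I
      -- If the orbit already lies in `I`, the union lemma is applied to `I` with the orbit removed.
      · have hw' : w ∉ symmDiff I (orbitFinset σ w) := by
          simp [mem_symmDiff, hw, hwC]
        have := signOn_union_orbit (hinv I h) hw'
        rw [← hout _ (hinv I h) hw', symmDiff_symmDiff_cancel_right] at this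
        rw [this]
        ring
      · have := signOn_union_orbit h hw
        rw [← hout I h hw] at this
        rw [this]
        ring
    · have h' : ¬ ∀ x, σ x ∈ symmDiff I (orbitFinset σ w) ↔ x ∈ symmDiff I (orbitFinset σ w) := by
        intro h'
        have := hinv _ h'
        rw [symmDiff_symmDiff_cancel_right] at this
        exact h this
      rw [signOn_of_not_invariant h, signOn_of_not_invariant h']
      simp
  · intro I _ _ heq
    have := congrArg (w ∈ ·) heq
    simp [mem_symmDiff, hwC] at this
  · intro I hI
    simpa [mem_symmDiff, hvC] using hI
  · intro I _
    exact symmDiff_symmDiff_cancel_right _ _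

/-- The bound on the cardinality matters: on one point the identity is transitive but is not a
cycle. -/
theorem isCycle_support_univ_iff (hV : 2 ≤ Fintype.card V) (σ : Perm V) (v : V) :
    (σ.IsCycle ∧ σ.support = univ) ↔ ∀ w, σ.SameCycle v w := by
  constructor
  · rintro ⟨hc, hs⟩ w
    have h : ∀ x, σ x ≠ x := fun x => mem_support.1 (hs ▸ mem_univ x)
    exact hc.sameCycle (h v) (h w)
  · intro h
    have hne : ∀ x, σ x ≠ x := by
      intro x hx
      have : Subsingleton V := by
        refine ⟨fun a b => ?_⟩
        rw [← ((h x).symm.trans (h a)).eq_of_left hx, ← ((h x).symm.trans (h b)).eq_of_left hx]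
      have := Fintype.card_le_one_iff_subsingleton.2 this
      omega
    exact ⟨⟨v, hne v, fun y _ => h y⟩, by ext x; simp [hne]⟩

open Classical in
theorem sum_signOn (hV : 2 ≤ Fintype.card V) (σ : Perm V) (v : V) :
    ∑ I : Finset V with v ∈ I, (-1) ^ #I * signOn σ I =
      if σ.IsCycle ∧ σ.support = univ then -1 else 0 := by
  split_ifs with hσ
  · rw [Finset.sum_eq_single univ]
    · rw [signOn_univ, hσ.1.sign, hσ.2]
      have : ((-1 : ℤ) ^ #(univ : Finset V)) * (-1) ^ #(univ : Finset V) = 1 := by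
        rw [← mul_pow]; simp
      push_cast
      linear_combination -this
    · intro I hI hne
      rw [signOn_of_not_invariant, mul_zero]
      intro h
      refine hne (eq_univ_of_forall fun w => ?_)
      exact (sameCycle_mem_iff h ((isCycle_support_univ_iff hV σ v).1 hσ w)).1 (by simpa using hI)
    · simp
  · rw [isCycle_support_univ_iff hV σ v] at hσ
    push Not at hσ
    obtain ⟨w, hw⟩ := hσ
    exact sum_signOn_eq_zero hw

-- The factor `#I` counts the points `v ∈ I`; exchanging the sums reduces to `sum_signOn` for each
-- `v`, which yields the factor `n`.
open Classical in
theorem sum_card_mul_signOn (hV : 2 ≤ Fintype.card V) (σ : Perm V) :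
    ∑ I : Finset V, (#I : ℤ) * ((-1) ^ #I * signOn σ I) =
      if σ.IsCycle ∧ σ.support = univ then -(Fintype.card V : ℤ) else 0 := by
  have : ∀ I : Finset V, (#I : ℤ) * ((-1) ^ #I * signOn σ I) =
      ∑ v : V, if v ∈ I then (-1) ^ #I * signOn σ I else 0 := by
    intro I
    simp
  simp_rw [this]
  rw [Finset.sum_comm]
  simp_rw [← Finset.sum_filter, sum_signOn hV]
  simp

end InvariantSets

/-! ### Expansion of the permanent-determinant coefficients. -/

section PerDet

variable {K : Type u} [CommRing K] {V : Type v} [Fintype V] [DecidableEq V]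

theorem det_deletePrincipal_compl (M : Matrix V V K) (I : Finset V) :
    (deletePrincipal M Iᶜ).det =
      (M.submatrix (Subtype.val : {i // i ∈ I} → V) Subtype.val).det := by
  rw [← Matrix.det_submatrix_equiv_self
    (Equiv.subtypeEquivRight (fun i => by simp) : {i // i ∈ I} ≃ {i // i ∉ Iᶜ})]
  rfl

/-- A permutation of `I` and one of its complement glue to a permutation of `V` preserving `I`, and
every such permutation splits uniquely in this way. -/
theorem permanent_mul_det_eq_sum (M : Matrix V V K) (I : Finset V) :
    (deletePrincipal M I).permanent * (deletePrincipal M Iᶜ).det =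
      ∑ σ : Perm V, (signOn σ I : K) * ∏ i, M (σ i) i := by
  classical
  rw [det_deletePrincipal_compl, mul_comm, Matrix.det_apply', Matrix.permanent,
    Finset.sum_mul_sum, ← Finset.sum_product']
  symm
  have hz : ∀ σ ∈ (univ : Finset (Perm V)), σ ∉ univ.filter (fun σ => ∀ x, σ x ∈ I ↔ x ∈ I) →
      (signOn σ I : K) * ∏ i, M (σ i) i = 0 := by
    intro σ _ hσ
    rw [signOn_of_not_invariant (by simpa using hσ)]
    simp
  rw [← Finset.sum_subset (Finset.filter_subset _ _) hz]
  refine Finset.sum_bij'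
    (fun σ hσ => (σ.subtypePerm (p := (· ∈ I)) (mem_filter.1 hσ).2,
      σ.subtypePerm (p := fun x => ¬ x ∈ I) fun x => not_congr ((mem_filter.1 hσ).2 x)))
    (fun e _ => e.1.subtypeCongr e.2) ?_ ?_ ?_ ?_ ?_
  · simp
  · intro e _
    simp only [mem_filter, mem_univ, true_and]
    intro x
    by_cases hx : x ∈ I
    · simp [subtypeCongr.left_apply, hx]
    · simpa [subtypeCongr.right_apply, hx] using (e.2 ⟨x, hx⟩).2
  · intro σ hσ
    ext x
    by_cases hx : x ∈ I
    · simp [subtypeCongr.left_apply, hx]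
    · simp [subtypeCongr.right_apply, hx]
  · intro e _
    ext x
    · simp
    · simp [subtypeCongr.right_apply, x.2]
  · intro σ hσ
    rw [signOn_of_invariant (mem_filter.1 hσ).2,
      ← Fintype.prod_subtype_mul_prod_subtype (· ∈ I) fun i => M (σ i) i]
    simp only [deletePrincipal, Matrix.submatrix_apply, subtypePerm_apply, mul_assoc]
    congr!

open Classical in
/-- The weighted sum of the coefficients of a matrix counts, with weights, the permutations
consisting of one cycle through all the indices. -/
theorem sum_perDetCoeff (hV : 2 ≤ Fintype.card V) (M : Matrix V V K) :
    ∑ l ∈ Icc 1 (Fintype.card V), (l : K) * (-1) ^ (l - 1) * perDetCoeff M l =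
      (Fintype.card V : K) *
        ∑ σ : Perm V with σ.IsCycle ∧ σ.support = univ, ∏ i, M (σ i) i := by
  -- The term `l = 0` can be added because of its factor `l`; the sum then runs over all subsets.
  have h0 : ∑ l ∈ Icc 1 (Fintype.card V), (l : K) * (-1) ^ (l - 1) * perDetCoeff M l =
      ∑ l ∈ range (#(univ : Finset V) + 1), ∑ I ∈ (univ : Finset V).powersetCard l,
        -((#I : K) * (-1) ^ #I *
          ((deletePrincipal M I).permanent * (deletePrincipal M Iᶜ).det)) := by
    have hsub : Icc 1 (Fintype.card V) ⊆ range (#(univ : Finset V) + 1) := by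
      intro l hl
      rw [mem_Icc] at hl
      rw [mem_range, card_univ]
      omega
    rw [← Finset.sum_subset hsub]
    · refine Finset.sum_congr rfl fun l hl => ?_
      rw [perDetCoeff, Finset.mul_sum]
      refine Finset.sum_congr rfl fun I hI => ?_
      rw [(mem_powersetCard.1 hI).2]
      obtain ⟨k, rfl⟩ : ∃ k, l = k + 1 := ⟨l - 1, by have := (mem_Icc.1 hl).1; omega⟩
      rw [Nat.add_sub_cancel, pow_succ]
      ring
    · intro l hl hl'
      refine Finset.sum_eq_zero fun I hI => ?_
      rw [(mem_powersetCard.1 hI).2]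
      rw [mem_range, card_univ] at hl
      rw [mem_Icc] at hl'
      obtain rfl : l = 0 := by omega
      simp
  rw [h0, ← Finset.sum_powerset, powerset_univ]
  simp_rw [permanent_mul_det_eq_sum, Finset.mul_sum, ← Finset.sum_neg_distrib]
  rw [Finset.sum_comm, Finset.sum_filter]
  refine Finset.sum_congr rfl fun σ _ => ?_
  have hσ := congrArg (Int.cast (R := K)) (sum_card_mul_signOn hV σ)
  push_cast at hσ
  have : ∀ I : Finset V, -((#I : K) * (-1) ^ #I * ((signOn σ I : K) * ∏ i, M (σ i) i)) =
      ((#I : K) * ((-1) ^ #I * (signOn σ I : K))) * -∏ i, M (σ i) i := fun I => by ring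
  simp_rw [this]
  rw [← Finset.sum_mul, hσ]
  split_ifs <;> ring

end PerDet

/-! ### Cyclic permutations along a relation. -/

section CyclePerms

variable {V : Type v} [Fintype V] [DecidableEq V]

/-- The permutations of `V` which consist of one cycle through all the points and all of whose
arcs `i → σ i` belong to the relation `R`. -/
def cyclePerms (R : V → V → Prop) : Set (Perm V) :=
  {σ | σ.IsCycle ∧ σ.support = univ ∧ ∀ i, R i (σ i)}

variable {R : V → V → Prop} {σ τ : Perm V}

theorem isCycleOn_univ (h : σ ∈ cyclePerms R) : σ.IsCycleOn ((univ : Finset V) : Set V) := by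
  refine ⟨by simp, fun x _ y _ => ?_⟩
  have h' : ∀ x, σ x ≠ x := fun x => mem_support.1 (h.2.1 ▸ mem_univ x)
  exact h.1.sameCycle (h' x) (h' y)

theorem pow_apply_eq_self_iff (h : σ ∈ cyclePerms R) (a : V) (k : ℕ) :
    (σ ^ k) a = a ↔ Fintype.card V ∣ k := by
  rw [(isCycleOn_univ h).pow_apply_eq (mem_univ a), card_univ]

theorem pow_apply_eq_pow_apply_iff (h : σ ∈ cyclePerms R) (a : V) {j k : ℕ}
    (hj : j < Fintype.card V) (hk : k < Fintype.card V) : (σ ^ j) a = (σ ^ k) a ↔ j = k := by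
  rw [(isCycleOn_univ h).pow_apply_eq_pow_apply (mem_univ a), card_univ]
  exact ⟨fun h => h.eq_of_lt_of_lt hj hk, fun h => h ▸ rfl⟩

theorem exists_pow_apply_eq (h : σ ∈ cyclePerms R) (a b : V) :
    ∃ k < Fintype.card V, (σ ^ k) a = b := by
  simpa using (isCycleOn_univ h).exists_pow_eq (mem_univ a) (mem_univ b)

theorem inv_mem_cyclePerms (hR : ∀ i j, R i j → R j i) (h : σ ∈ cyclePerms R) : σ⁻¹ ∈ cyclePerms R := by
  refine ⟨h.1.inv, by rw [support_inv, h.2.1], fun i => hR _ _ ?_⟩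
  simpa using h.2.2 (σ⁻¹ i)

theorem apply_apply_ne (hV : 3 ≤ Fintype.card V) (h : σ ∈ cyclePerms R) (a : V) :
    σ (σ a) ≠ a := by
  intro ha
  have := (pow_apply_eq_self_iff h a 2).1 (by simpa [pow_two] using ha)
  have := Nat.le_of_dvd (by norm_num) this
  omega

theorem inv_ne_self (hV : 3 ≤ Fintype.card V) (h : σ ∈ cyclePerms R) : σ ≠ σ⁻¹ := by
  intro he
  have : Nonempty V := Fintype.card_pos_iff.1 (by omega)
  refine apply_apply_ne hV h (Classical.arbitrary V) ?_
  nth_rw 1 [he]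
  simp

/-- The hypothesis says that every step of `τ` runs along the cycle of `σ`, forwards or backwards. A
forward step cannot be followed by a backward one, since `τ` would then return after two steps; so
one forward step forces all steps to be forward. -/
theorem eq_or_eq_inv (hV : 3 ≤ Fintype.card V) (hσ : σ ∈ cyclePerms R) (hτ : τ ∈ cyclePerms R)
    (h : ∀ x, τ x = σ x ∨ σ (τ x) = x) : τ = σ ∨ τ = σ⁻¹ := by
  by_cases ha : ∃ a, τ a = σ a
  · left
    obtain ⟨a, ha⟩ := ha
    have key : ∀ k, (τ ^ k) a = (σ ^ k) a ∧ τ ((σ ^ k) a) = σ ((σ ^ k) a) := by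
      intro k
      induction k with
      | zero => simpa using ha
      | succ k ih =>
        have h1 : (τ ^ (k + 1)) a = (σ ^ (k + 1)) a := by
          rw [pow_succ', pow_succ', Perm.mul_apply, Perm.mul_apply, ih.1, ih.2]
        refine ⟨h1, (h _).resolve_right fun h2 => ?_⟩
        rw [pow_succ', Perm.mul_apply] at h2
        refine apply_apply_ne hV hτ ((σ ^ k) a) ?_
        rw [ih.2]
        exact σ.injective h2
    ext b
    obtain ⟨k, -, rfl⟩ := exists_pow_apply_eq hσ a b
    exact (key k).2
  · right
    push Not at ha
    ext x
    rw [Perm.eq_inv_iff_eq]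
    exact (h x).resolve_left (ha x)

-- A cycle with full support has no fixed point, so no diagonal entry occurs in its product and
-- `lam` drops out.
open Classical in
theorem sum_prod_paramMatrix {K : Type u} [CommRing K] (lam : V → K)
    (B : Matrix V V K) (hB : ∀ i j, B i j = if R i j then 1 else 0) :
    ∑ σ : Perm V with σ.IsCycle ∧ σ.support = univ, ∏ i, paramMatrix B lam (σ i) i =
      ((cyclePerms R).ncard : K) := by
  have h1 : ∑ σ : Perm V with σ.IsCycle ∧ σ.support = univ, ∏ i, paramMatrix B lam (σ i) i =
      ∑ σ : Perm V with σ.IsCycle ∧ σ.support = univ, if ∀ i, R i (σ i) then 1 else 0 := by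
    -- The entries `B (σ i) i` record arcs from `σ i` to `i`, whereas `cyclePerms` asks for arcs
    -- from `i` to `σ i`; inversion reconciles the two.
    refine Finset.sum_bij' (fun σ _ => σ⁻¹) (fun σ _ => σ⁻¹) ?_ ?_ ?_ ?_ ?_
    · simp
    · simp
    · simp
    · simp
    · intro σ hσ
      have hσ' : ∀ i, σ i ≠ i := fun i => mem_support.1 ((mem_filter.1 hσ).2.2 ▸ mem_univ i)
      simp only [paramMatrix, Matrix.of_apply, hσ', if_false, hB]
      rw [Finset.prod_ite_zero, prod_const_one]
      congr 1
      simp only [mem_univ, true_imp_iff, eq_iff_iff]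
      exact ⟨fun h i => by simpa using h (σ⁻¹ i), fun h i => by simpa using h (σ i)⟩
  rw [h1, Finset.sum_boole, Finset.filter_filter, Set.ncard_eq_toFinset_card']
  congr 2
  ext σ
  simp only [mem_filter, mem_univ, true_and, Set.mem_toFinset, and_assoc]
  rfl

end CyclePerms

/-! ### Hamiltonian cycles of a graph as pairs of cyclic permutations. -/

section Subgraphs

variable {V : Type v} {G : SimpleGraph V}

/-- The spanning subgraph of `G` with the edges `{i, σ i}`. -/
def cycleSubgraph (G : SimpleGraph V) (σ : Perm V) : G.Subgraph where
  verts := Set.univ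
  Adj i j := G.Adj i j ∧ (σ i = j ∨ σ j = i)
  adj_sub h := h.1
  edge_vert _ := Set.mem_univ _
  symm := ⟨fun _ _ h => ⟨h.1.symm, h.2.symm⟩⟩

theorem cycleSubgraph_inv (σ : Perm V) : cycleSubgraph G σ⁻¹ = cycleSubgraph G σ := by
  ext i j
  · rfl
  · simp only [cycleSubgraph, Perm.inv_eq_iff_eq]
    tauto

theorem toSubgraph_eq_cycleSubgraph {σ : Perm V} (hσ : ∀ i, G.Adj i (σ i)) {a b : V}
    (p : G.Walk a b) (hp : ∀ i < p.length, σ (p.getVert i) = p.getVert (i + 1))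
    (hsurj : ∀ x, ∃ i < p.length, p.getVert i = x) : p.toSubgraph = cycleSubgraph G σ := by
  ext x y
  · simp only [SimpleGraph.Walk.mem_verts_toSubgraph, cycleSubgraph, Set.mem_univ, iff_true]
    obtain ⟨i, -, rfl⟩ := hsurj x
    exact p.getVert_mem_support i
  · rw [SimpleGraph.Walk.toSubgraph_adj_iff]
    constructor
    · rintro ⟨i, he, hi⟩
      rw [← hp i hi, Sym2.eq_iff] at he
      rcases he with ⟨rfl, rfl⟩ | ⟨rfl, rfl⟩
      · exact ⟨hσ _, Or.inl rfl⟩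
      · exact ⟨(hσ _).symm, Or.inr rfl⟩
    · rintro ⟨-, rfl | rfl⟩
      · obtain ⟨i, hi, rfl⟩ := hsurj x
        exact ⟨i, by rw [hp i hi], hi⟩
      · obtain ⟨i, hi, rfl⟩ := hsurj y
        exact ⟨i, by rw [hp i hi, Sym2.eq_swap], hi⟩

/-- The walk `a, σ a, σ² a, …` of length `k`. -/
def permWalk {σ : Perm V} (hσ : ∀ i, G.Adj i (σ i)) : ∀ (a : V) (k : ℕ), G.Walk a (σ^[k] a)
  | _, 0 => .nil
  | a, k + 1 => .cons (hσ a) (permWalk hσ (σ a) k)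

theorem length_permWalk {σ : Perm V} (hσ : ∀ i, G.Adj i (σ i)) (a : V) (k : ℕ) :
    (permWalk hσ a k).length = k := by
  induction k generalizing a with
  | zero => rfl
  | succ k ih => simp [permWalk, ih]

theorem getVert_permWalk {σ : Perm V} (hσ : ∀ i, G.Adj i (σ i)) (a : V) {k i : ℕ} (hi : i ≤ k) :
    (permWalk hσ a k).getVert i = (σ ^ i) a := by
  induction k generalizing a i with
  | zero =>
    obtain rfl : i = 0 := by omega
    rfl
  | succ k ih =>
    cases i with
    | zero => exact SimpleGraph.Walk.getVert_zero _
    | succ i =>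
      rw [pow_succ, Perm.mul_apply]
      exact ih (σ a) (by omega)

variable [Fintype V] [DecidableEq V]

theorem exists_isHamiltonianCycle_of_mem_cyclePerms (hV : 3 ≤ Fintype.card V) {σ : Perm V}
    (h : σ ∈ cyclePerms G.Adj) :
    ∃ (a : V) (p : G.Walk a a), p.IsHamiltonianCycle ∧ p.toSubgraph = cycleSubgraph G σ := by
  have : Nonempty V := Fintype.card_pos_iff.1 (by omega)
  let a : V := Classical.arbitrary V
  obtain ⟨n, hn⟩ : ∃ n, Fintype.card V = n + 1 := ⟨Fintype.card V - 1, by omega⟩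
  have hend : σ^[n] (σ a) = a := by
    rw [← Function.iterate_succ_apply, Perm.iterate_eq_pow, pow_apply_eq_self_iff h, hn]
  let q : G.Walk (σ a) a := (permWalk h.2.2 (σ a) n).copy rfl hend
  have hq : q.length = n := by simp [q, length_permWalk]
  have hqv : ∀ i ≤ n, q.getVert i = (σ ^ (i + 1)) a := by
    intro i hi
    simp [q, getVert_permWalk _ _ hi, pow_succ]
  have hq0 : ∀ i < n, q.getVert i ≠ a := by
    intro i hi hia
    rw [hqv i hi.le, pow_apply_eq_self_iff h] at hia
    have := Nat.le_of_dvd (by omega) hia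
    omega
  have hqinj : ∀ i ≤ n, ∀ j ≤ n, q.getVert i = q.getVert j → i = j := by
    intro i hi j hj hij
    rw [hqv i hi, hqv j hj, pow_succ, pow_succ, Perm.mul_apply, Perm.mul_apply] at hij
    exact (pow_apply_eq_pow_apply_iff h _ (by omega) (by omega)).1 hij
  have hcyc : (SimpleGraph.Walk.cons (h.2.2 a) q).IsCycle := by
    rw [SimpleGraph.Walk.cons_isCycle_iff]
    constructor
    · rw [← SimpleGraph.Walk.IsPath.getVert_injOn_iff]
      intro i hi j hj hij
      simp only [Set.mem_ofPred_eq, hq] at hi hj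
      exact hqinj i hi j hj hij
    -- If the first edge recurred in `q`, then `q` would visit `a` before its last vertex, either at
    -- once or at index `1`; the latter is too early because `n ≥ 2`.
    · intro he
      rw [← SimpleGraph.Walk.adj_toSubgraph_iff_mem_edges,
        SimpleGraph.Walk.toSubgraph_adj_iff] at he
      obtain ⟨i, he, hi⟩ := he
      rw [hq] at hi
      rw [Sym2.eq_iff] at he
      rcases he with ⟨h1, -⟩ | ⟨h1, h2⟩
      · exact hq0 i hi h1
      · obtain rfl : i = 0 := hqinj i hi.le 0 (by omega) (by rw [h1]; simp)
        exact hq0 1 (by omega) h2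
  refine ⟨a, .cons (h.2.2 a) q, ?_, ?_⟩
  · rw [SimpleGraph.Walk.isHamiltonianCycle_iff_isCycle_and_length_eq]
    exact ⟨hcyc, by simp [hq, hn]⟩
  · have hv : ∀ i ≤ n + 1, (SimpleGraph.Walk.cons (h.2.2 a) q).getVert i = (σ ^ i) a := by
      intro i hi
      cases i with
      | zero => simp
      | succ i => rw [SimpleGraph.Walk.getVert_cons_succ, hqv i (by omega)]
    refine toSubgraph_eq_cycleSubgraph h.2.2 _ ?_ ?_
    · intro i hi
      simp only [SimpleGraph.Walk.length_cons, hq] at hi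
      rw [hv i hi.le, hv (i + 1) (by omega), pow_succ', Perm.mul_apply]
    · intro x
      obtain ⟨i, hi, rfl⟩ := exists_pow_apply_eq h a x
      exact ⟨i, by simp [hq]; omega, hv i (by omega)⟩

/-- The support of the closed walk lists its base point twice; its tail lists each vertex once, so
`List.formPerm` of the tail is the successor map. -/
theorem exists_mem_cyclePerms_of_isHamiltonianCycle {a : V} {p : G.Walk a a}
    (hp : p.IsHamiltonianCycle) :
    ∃ σ ∈ cyclePerms G.Adj, cycleSubgraph G σ = p.toSubgraph := by
  have hlen := hp.length_eq
  have h3 := hp.isCycle.three_le_length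
  have hnd := hp.isCycle.support_nodup
  have htl : p.support.tail.length = p.length := by simp
  have hget : ∀ i (hi : i < p.support.tail.length), p.support.tail[i] = p.getVert (i + 1) := by
    intro i hi
    rw [List.getElem_tail, SimpleGraph.Walk.support_getElem_eq_getVert]
  have hσ : ∀ i < p.length, p.support.tail.formPerm (p.getVert i) = p.getVert (i + 1) := by
    intro i hi
    cases i with
    | zero =>
      -- The base point is the last entry of the tail, so its successor is found by wrapping around
      -- to index `0`.
      have h1 := List.formPerm_apply_getElem _ hnd (p.length - 1) (by omega)
      simp only [hget, htl, Nat.sub_add_cancel (show 1 ≤ p.length by omega), Nat.mod_self] at h1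
      simpa using h1
    | succ i =>
      have h1 := List.formPerm_apply_getElem _ hnd i (by omega)
      simpa only [hget, htl, Nat.mod_eq_of_lt hi] using h1
  have hsurj : ∀ x, ∃ i < p.length, p.getVert i = x := by
    intro x
    obtain ⟨i, rfl, hi⟩ := SimpleGraph.Walk.mem_support_iff_exists_getVert.1 (hp.mem_support x)
    rcases hi.eq_or_lt with rfl | hi
    · exact ⟨0, by omega, by simp⟩
    · exact ⟨i, hi, rfl⟩
  have hmem : p.support.tail.formPerm ∈ cyclePerms G.Adj := by
    refine ⟨List.isCycle_formPerm hnd (by omega), ?_, ?_⟩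
    · rw [List.support_formPerm_of_nodup _ hnd]
      · rw [← card_eq_iff_eq_univ, List.toFinset_card_of_nodup hnd, htl, hlen]
      · intro x hx
        rw [hx] at htl
        simp at htl
        omega
    · intro x
      obtain ⟨i, hi, rfl⟩ := hsurj x
      rw [hσ i hi]
      exact p.adj_getVert_succ hi
  exact ⟨_, hmem, (toSubgraph_eq_cycleSubgraph hmem.2.2 p hσ hsurj).symm⟩

theorem cycleSubgraph_eq_iff (hV : 3 ≤ Fintype.card V) {σ τ : Perm V}
    (hσ : σ ∈ cyclePerms G.Adj) (hτ : τ ∈ cyclePerms G.Adj) :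
    cycleSubgraph G τ = cycleSubgraph G σ ↔ τ = σ ∨ τ = σ⁻¹ := by
  constructor
  · intro h
    refine eq_or_eq_inv hV hσ hτ fun x => ?_
    have : (cycleSubgraph G τ).Adj x (τ x) := ⟨hτ.2.2 x, Or.inl rfl⟩
    rw [h] at this
    exact this.2.imp_left Eq.symm
  · rintro (rfl | rfl)
    · rfl
    · exact cycleSubgraph_inv σ

/-- Each fibre of `cycleSubgraph` is a pair `{σ, σ⁻¹}` of distinct permutations, the two
orientations. -/
theorem ncard_cyclePerms_eq (hV : 3 ≤ Fintype.card V) :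
    (cyclePerms G.Adj).ncard = 2 * hamCycleCount G := by
  classical
  have himg : {H : G.Subgraph | ∃ (a : V) (p : G.Walk a a),
      p.IsHamiltonianCycle ∧ p.toSubgraph = H} =
        (((cyclePerms G.Adj).toFinset.image (cycleSubgraph G) : Finset G.Subgraph) :
          Set G.Subgraph) := by
    ext H
    simp only [Set.mem_ofPred_eq, coe_image, Set.coe_toFinset, Set.mem_image]
    constructor
    · rintro ⟨a, p, hp, rfl⟩
      exact exists_mem_cyclePerms_of_isHamiltonianCycle hp
    · rintro ⟨σ, hσ, rfl⟩
      exact exists_isHamiltonianCycle_of_mem_cyclePerms hV hσ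
  rw [hamCycleCount, himg, Set.ncard_coe_finset, Set.ncard_eq_toFinset_card',
    Finset.card_eq_sum_card_image (cycleSubgraph G), mul_comm, ← smul_eq_mul,
    ← Finset.sum_const]
  refine Finset.sum_congr rfl fun H hH => ?_
  obtain ⟨σ, hσ, rfl⟩ := Finset.mem_image.1 hH
  rw [Set.mem_toFinset] at hσ
  have : {τ ∈ (cyclePerms G.Adj).toFinset | cycleSubgraph G τ = cycleSubgraph G σ} =
      {σ, σ⁻¹} := by
    ext τ
    simp only [mem_filter, Set.mem_toFinset, mem_insert, mem_singleton]
    constructor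
    · rintro ⟨hτ, h⟩
      exact (cycleSubgraph_eq_iff hV hσ hτ).1 h
    · rintro (rfl | rfl)
      · exact ⟨hσ, rfl⟩
      · exact ⟨inv_mem_cyclePerms (fun _ _ h => h.symm) hσ, cycleSubgraph_inv σ⟩
  rw [this, card_pair (inv_ne_self hV hσ)]

end Subgraphs

/-! ### The enumeration formulas for graphs and digraphs. -/

theorem sum_perDetCoeff_paramMatrix {K : Type u} [CommRing K] {V : Type v} [Fintype V]
    [DecidableEq V] {R : V → V → Prop} [DecidableRel R] (hV : 2 ≤ Fintype.card V) (lam : V → K)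
    (B : Matrix V V K) (hB : ∀ i j, B i j = if R i j then 1 else 0) :
    ∑ l ∈ Icc 1 (Fintype.card V), (l : K) * (-1) ^ (l - 1) * perDetCoeff (paramMatrix B lam) l =
      (Fintype.card V : K) * ((cyclePerms R).ncard : K) := by
  rw [sum_perDetCoeff hV, sum_prod_paramMatrix lam B fun i j => by rw [hB]; congr]

theorem hamCycleCount_eq {K : Type u} [Field K] [CharZero K] {V : Type v} [Fintype V]
    [DecidableEq V] (G : SimpleGraph V) [DecidableRel G.Adj] (lam : V → K)
    (hV : 3 ≤ Fintype.card V) :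
    (hamCycleCount G : K) = 1 / (2 * (Fintype.card V : K)) *
      ∑ l ∈ Icc 1 (Fintype.card V), (l : K) * (-1) ^ (l - 1) *
        perDetCoeff (paramMatrix (G.adjMatrix K) lam) l := by
  rw [sum_perDetCoeff_paramMatrix (R := G.Adj) (by omega) lam _ fun i j => by
    rw [SimpleGraph.adjMatrix_apply], ncard_cyclePerms_eq hV]
  have : (Fintype.card V : K) ≠ 0 := by
    rw [Nat.cast_ne_zero]
    omega
  push_cast
  field_simp

theorem diHamCycleCount_eq {K : Type u} [Field K] [CharZero K] {V : Type v} [Fintype V]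
    [DecidableEq V] (D : Digraph V) [DecidableRel D.Adj] (lam : V → K)
    (hV : 2 ≤ Fintype.card V) :
    (diHamCycleCount D : K) = 1 / (Fintype.card V : K) *
      ∑ l ∈ Icc 1 (Fintype.card V), (l : K) * (-1) ^ (l - 1) *
        perDetCoeff (paramMatrix (diAdjMatrix K D) lam) l := by
  rw [sum_perDetCoeff_paramMatrix (R := D.Adj) hV lam (diAdjMatrix K D) fun i j => rfl]
  have : (Fintype.card V : K) ≠ 0 := by
    rw [Nat.cast_ne_zero]
    omega
  rw [← mul_assoc, one_div_mul_cancel this, one_mul]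
  rfl

/-! ### Principal minors that vanish or are small. -/

section Determinants

variable {K : Type u} [CommRing K] {V : Type v} [Fintype V] [DecidableEq V]

theorem det_deletePrincipal_compl_eq_zero (M : Matrix V V K) {I : Finset V} {x y : V}
    (hx : x ∈ I) (hy : y ∈ I) (hxy : x ≠ y) (h : ∀ j, M x j = M y j) :
    (deletePrincipal M Iᶜ).det = 0 := by
  rw [det_deletePrincipal_compl]
  exact Matrix.det_zero_of_row_eq (i := ⟨x, hx⟩) (j := ⟨y, hy⟩) (by simpa using hxy)
    (funext fun j => h j)

theorem det_deletePrincipal_compl_singleton (M : Matrix V V K) (x : V) :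
    (deletePrincipal M {x}ᶜ).det = M x x := by
  rw [det_deletePrincipal_compl,
    Matrix.det_eq_elem_of_card_eq_one (by simp) (⟨x, by simp⟩ : {i // i ∈ ({x} : Finset V)})]
  rfl

theorem det_deletePrincipal_compl_pair (M : Matrix V V K) {x y : V} (hxy : x ≠ y) :
    (deletePrincipal M {x, y}ᶜ).det = M x x * M y y - M x y * M y x := by
  let f : Fin 2 → {i // i ∈ ({x, y} : Finset V)} := ![⟨x, by simp⟩, ⟨y, by simp⟩]
  have hf : Function.Bijective f := by
    rw [Fintype.bijective_iff_injective_and_card]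
    refine ⟨?_, by rw [Fintype.card_fin, Fintype.card_coe, card_pair hxy]⟩
    intro i j
    fin_cases i <;> fin_cases j <;> simp [f, hxy, hxy.symm]
  rw [det_deletePrincipal_compl, ← Matrix.det_submatrix_equiv_self (Equiv.ofBijective f hf),
    Matrix.det_fin_two]
  rfl

end Determinants

/-! ### Permanents of all-ones and bipartite matrices. -/

section Permanents

variable {K : Type u} [CommRing K] {W : Type v} [Fintype W] [DecidableEq W]

theorem permanent_of_forall_eq_one (M : Matrix W W K) (h : ∀ i j, M i j = 1) :
    M.permanent = ((Fintype.card W).factorial : K) := by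
  simp [Matrix.permanent, h, Fintype.card_perm]

/-- A permutation exchanging a set with its complement is a pair of bijections. -/
def permSwapEquiv (p : W → Prop) [DecidablePred p] :
    {σ : Perm W // ∀ i, p i ↔ ¬ p (σ i)} ≃
      ({i // p i} ≃ {i // ¬ p i}) × ({i // ¬ p i} ≃ {i // ¬ ¬ p i}) where
  toFun σ := (σ.1.subtypeEquiv fun i => σ.2 i, σ.1.subtypeEquiv fun i => not_congr (σ.2 i))
  invFun e := ⟨Equiv.subtypeCongr e.1 e.2, fun i => by
    by_cases h : p i
    · simpa [Equiv.subtypeCongr, h] using (e.1 ⟨i, h⟩).2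
    · simpa [Equiv.subtypeCongr, h] using (e.2 ⟨i, h⟩).2⟩
  left_inv σ := by
    ext i
    by_cases h : p i <;> simp [Equiv.subtypeCongr, h]
  right_inv e := by
    ext i
    · simp [Equiv.subtypeCongr, i.2]
    · simp [Equiv.subtypeCongr, i.2]

theorem card_equiv_eq_ite {α β : Type*} [Fintype α] [Fintype β] [DecidableEq α] [DecidableEq β] :
    Fintype.card (α ≃ β) =
      if Fintype.card α = Fintype.card β then (Fintype.card α).factorial else 0 := by
  split_ifs with h
  · exact Fintype.card_equiv (Fintype.equivOfCardEq h)
  · rw [Fintype.card_eq_zero_iff]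
    exact ⟨fun e => h (Fintype.card_congr e)⟩

/-- Only permutations exchanging the two sides contribute; each is a pair of bijections between the
sides, which exist only when the sizes agree. -/
theorem permanent_bipartite (M : Matrix W W K) (p : W → Prop) [DecidablePred p]
    (h : ∀ i j, M i j = if p j ↔ ¬ p i then 1 else 0) :
    M.permanent = ((Fintype.card {i // p i}).factorial : K) *
      ((Fintype.card {i // ¬ p i}).factorial : K) *
        (if Fintype.card {i // p i} = Fintype.card {i // ¬ p i} then 1 else 0) := by
  have h1 : M.permanent = (Fintype.card {σ : Perm W // ∀ i, p i ↔ ¬ p (σ i)} : K) := by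
    simp_rw [Matrix.permanent, h, Finset.prod_ite_zero, prod_const_one]
    rw [Finset.sum_boole, Fintype.card_subtype]
    simp
  have h2 : Fintype.card {i // ¬ ¬ p i} = Fintype.card {i // p i} :=
    Fintype.card_congr (Equiv.subtypeEquivRight fun i => not_not)
  rw [h1, Fintype.card_congr (permSwapEquiv p), Fintype.card_prod, card_equiv_eq_ite,
    card_equiv_eq_ite, h2]
  split_ifs with h3 h4 h4
  · simp
  · exact absurd h3.symm h4
  · exact absurd h4.symm h3
  · simp

end Permanents

/-! ### The complete graph. -/

section CompleteGraph

variable {K : Type u}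

theorem perDetCoeff_of_forall_eq_one [CommRing K] {V : Type v} [Fintype V] [DecidableEq V]
    (M : Matrix V V K) (hM : ∀ i j, M i j = 1) {l : ℕ} (hl : 1 ≤ l) (hV : 1 ≤ Fintype.card V) :
    perDetCoeff M l = if l = 1 then ((Fintype.card V).factorial : K) else 0 := by
  rw [perDetCoeff]
  split_ifs with h1
  · subst h1
    have : ∀ I ∈ (univ : Finset V).powersetCard 1,
        (deletePrincipal M I).permanent * (deletePrincipal M Iᶜ).det =
          ((Fintype.card V - 1).factorial : K) := by
      intro I hI
      obtain ⟨x, rfl⟩ := card_eq_one.1 (mem_powersetCard.1 hI).2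
      rw [det_deletePrincipal_compl_singleton, hM, mul_one,
        permanent_of_forall_eq_one (deletePrincipal M {x}) fun i j => hM i j,
        Fintype.card_subtype_compl]
      simp
    rw [Finset.sum_congr rfl this, Finset.sum_const, card_powersetCard, card_univ,
      Nat.choose_one_right, nsmul_eq_mul, ← Nat.cast_mul, Nat.mul_factorial_pred (by omega)]
  · refine Finset.sum_eq_zero fun I hI => ?_
    have hI' := (mem_powersetCard.1 hI).2
    obtain ⟨x, hx, y, hy, hxy⟩ := one_lt_card.1 (by omega : 1 < #I)
    rw [det_deletePrincipal_compl_eq_zero M hx hy hxy fun j => by rw [hM, hM], mul_zero]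

theorem perDetCoeff_completeGraph [CommRing K] {n l : ℕ} (hn : 1 ≤ n) (hl : 1 ≤ l) :
    perDetCoeff (paramMatrix ((⊤ : SimpleGraph (Fin n)).adjMatrix K) fun _ => 1) l =
      if l = 1 then (n.factorial : K) else 0 := by
  have := perDetCoeff_of_forall_eq_one
    (paramMatrix ((⊤ : SimpleGraph (Fin n)).adjMatrix K) fun _ => 1) (fun i j => by
      by_cases h : i = j <;> simp [paramMatrix, h]) hl (by simpa using hn)
  simpa using this

theorem hamCycleCount_completeGraph [Field K] [CharZero K] {n : ℕ} (hn : 3 ≤ n) :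
    (hamCycleCount (⊤ : SimpleGraph (Fin n)) : K) = 1 / 2 * ((n - 1).factorial : K) := by
  rw [hamCycleCount_eq _ (fun _ => 1) (by simpa using hn), Fintype.card_fin,
    Finset.sum_eq_single_of_mem 1 (by rw [mem_Icc]; omega)]
  · rw [perDetCoeff_completeGraph (by omega) le_rfl, if_pos rfl,
      ← Nat.mul_factorial_pred (show n ≠ 0 by omega)]
    have : (n : K) ≠ 0 := by
      rw [Nat.cast_ne_zero]
      omega
    push_cast
    field_simp
  · intro l hl h1
    rw [perDetCoeff_completeGraph (by omega) (mem_Icc.1 hl).1, if_neg h1, mul_zero]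

end CompleteGraph

/-! ### The complete bipartite graph. -/

section CompleteBipartiteGraph

variable {K : Type u}

theorem paramMatrix_completeBipartiteGraph [CommRing K] (α β : Type*) [DecidableEq α]
    [DecidableEq β] [DecidableRel (completeBipartiteGraph α β).Adj] (i j : α ⊕ β) :
    paramMatrix ((completeBipartiteGraph α β).adjMatrix K) (fun _ => 0) i j =
      if j.isLeft ↔ ¬ i.isLeft then 1 else 0 := by
  rcases i with i | i <;> rcases j with j | j <;> simp [paramMatrix, SimpleGraph.adjMatrix_apply]

/-- Three vertices always include two on the same side, by pigeonhole. With zero diagonal such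
vertices have equal rows, so this isolates the only sets of size at least two whose minor can be
nonzero. -/
theorem exists_ne_isLeft_eq {α β : Type*} [DecidableEq α] [DecidableEq β] {I : Finset (α ⊕ β)}
    (hI : 2 ≤ #I) (hI' : ∀ a b, I ≠ {Sum.inl a, Sum.inr b}) :
    ∃ x ∈ I, ∃ y ∈ I, x ≠ y ∧ x.isLeft = y.isLeft := by
  rcases hI.eq_or_lt with h2 | h2
  · obtain ⟨x, y, hxy, rfl⟩ := card_eq_two.1 h2.symm
    refine ⟨x, by simp, y, by simp, hxy, ?_⟩
    rcases x with x | x <;> rcases y with y | y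
    · rfl
    · exact absurd rfl (hI' x y)
    · exact absurd (pair_comm _ _) (hI' y x)
    · rfl
  · exact exists_ne_map_eq_of_card_lt_of_maps_to (t := univ) (by simpa using h2)
      fun _ _ => mem_coe.2 (mem_univ _)

theorem permanent_deletePrincipal_bipartite [CommRing K] (n₁ n₂ : ℕ)
    [DecidableRel (completeBipartiteGraph (Fin n₁) (Fin n₂)).Adj] (a : Fin n₁) (b : Fin n₂) :
    (deletePrincipal (paramMatrix ((completeBipartiteGraph (Fin n₁) (Fin n₂)).adjMatrix K)
      fun _ => 0) {Sum.inl a, Sum.inr b}).permanent =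
      ((n₁ - 1).factorial : K) * ((n₂ - 1).factorial : K) * (if n₁ - 1 = n₂ - 1 then 1 else 0) := by
  have h := permanent_bipartite (deletePrincipal
    (paramMatrix ((completeBipartiteGraph (Fin n₁) (Fin n₂)).adjMatrix K) fun _ => 0)
      {Sum.inl a, Sum.inr b}) (fun i => i.1.isLeft)
      (fun i j => paramMatrix_completeBipartiteGraph _ _ _ _)
  have h1 : Fintype.card {i : {i : Fin n₁ ⊕ Fin n₂ // i ∉ ({Sum.inl a, Sum.inr b} : Finset _)} //
      i.1.isLeft} = n₁ - 1 := by
    have e : {i : Fin n₁ // ¬ i = a} ≃ {i : {i : Fin n₁ ⊕ Fin n₂ //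
        i ∉ ({Sum.inl a, Sum.inr b} : Finset _)} // i.1.isLeft} :=
      Equiv.ofBijective (fun i => ⟨⟨Sum.inl i.1, by simpa using i.2⟩, rfl⟩) (by
        constructor
        · intro i j hij
          simpa [Subtype.ext_iff] using hij
        · rintro ⟨⟨i | i, hi⟩, hi'⟩
          · exact ⟨⟨i, by simpa using hi⟩, rfl⟩
          · simp at hi')
    rw [← Fintype.card_congr e, Fintype.card_subtype_compl]
    simp
  have h2 : Fintype.card {i : {i : Fin n₁ ⊕ Fin n₂ // i ∉ ({Sum.inl a, Sum.inr b} : Finset _)} //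
      ¬ i.1.isLeft} = n₂ - 1 := by
    have e : {i : Fin n₂ // ¬ i = b} ≃ {i : {i : Fin n₁ ⊕ Fin n₂ //
        i ∉ ({Sum.inl a, Sum.inr b} : Finset _)} // ¬ i.1.isLeft} :=
      Equiv.ofBijective (fun i => ⟨⟨Sum.inr i.1, by simpa using i.2⟩, by simp⟩) (by
        constructor
        · intro i j hij
          simpa [Subtype.ext_iff] using hij
        · rintro ⟨⟨i | i, hi⟩, hi'⟩
          · simp at hi'
          · exact ⟨⟨i, by simpa using hi⟩, rfl⟩)
    rw [← Fintype.card_congr e, Fintype.card_subtype_compl]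
    simp
  rw [h, h1, h2]

theorem perDetCoeff_completeBipartiteGraph [CommRing K] {n₁ n₂ l : ℕ}
    [DecidableRel (completeBipartiteGraph (Fin n₁) (Fin n₂)).Adj] (hn : 1 ≤ n₁ + n₂)
    (hl : 1 ≤ l) :
    perDetCoeff (paramMatrix ((completeBipartiteGraph (Fin n₁) (Fin n₂)).adjMatrix K)
      fun _ => 0) l =
      if l = 2 then -((n₁.factorial : K) * (n₂.factorial : K) * (if n₁ = n₂ then 1 else 0))
      else 0 := by
  set M := paramMatrix ((completeBipartiteGraph (Fin n₁) (Fin n₂)).adjMatrix K) fun _ => 0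
    with hM
  have hMij := paramMatrix_completeBipartiteGraph (K := K) (Fin n₁) (Fin n₂)
  have hzero : ∀ I : Finset (Fin n₁ ⊕ Fin n₂), 2 ≤ #I →
      (∀ a b, I ≠ {Sum.inl a, Sum.inr b}) → (deletePrincipal M Iᶜ).det = 0 := by
    intro I hI hI'
    obtain ⟨x, hx, y, hy, hxy, he⟩ := exists_ne_isLeft_eq hI hI'
    refine det_deletePrincipal_compl_eq_zero M hx hy hxy fun j => ?_
    rw [hM, hMij, hMij, he]
  rw [perDetCoeff]
  by_cases h2 : l = 2
  · subst h2
    rw [if_pos rfl]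
    let f : Fin n₁ × Fin n₂ → Finset (Fin n₁ ⊕ Fin n₂) := fun ab => {Sum.inl ab.1, Sum.inr ab.2}
    have hf : Function.Injective f := by
      rintro ⟨a, b⟩ ⟨a', b'⟩ h
      have h1 : Sum.inl a ∈ f (a', b') := h ▸ by simp [f]
      have h2 : Sum.inr b ∈ f (a', b') := h ▸ by simp [f]
      simp only [f, mem_insert, mem_singleton, Sum.inl.injEq, Sum.inr.injEq, reduceCtorEq,
        or_false, false_or] at h1 h2
      rw [h1, h2]
    have hsub : univ.image f ⊆ (univ : Finset (Fin n₁ ⊕ Fin n₂)).powersetCard 2 := by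
      intro I hI
      obtain ⟨ab, -, rfl⟩ := mem_image.1 hI
      exact mem_powersetCard.2 ⟨subset_univ _, card_pair (by simp)⟩
    rw [← Finset.sum_subset hsub, Finset.sum_image hf.injOn]
    · have hterm : ∀ ab ∈ (univ : Finset (Fin n₁ × Fin n₂)),
          (deletePrincipal M (f ab)).permanent * (deletePrincipal M (f ab)ᶜ).det =
            -(((n₁ - 1).factorial : K) * ((n₂ - 1).factorial : K) *
              (if n₁ - 1 = n₂ - 1 then 1 else 0)) := by
        intro ab _
        rw [permanent_deletePrincipal_bipartite, det_deletePrincipal_compl_pair M (by simp), hM,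
          hMij, hMij, hMij, hMij]
        simp
      rw [Finset.sum_congr rfl hterm, Finset.sum_const, card_univ, Fintype.card_prod,
        Fintype.card_fin, Fintype.card_fin, nsmul_eq_mul]
      -- An empty side is treated separately: with truncated subtraction `n₁ - 1 = n₂ - 1` does not
      -- imply `n₁ = n₂` there, but the number of mixed pairs is zero.
      rcases Nat.eq_zero_or_pos n₁ with h1 | h1
      · rw [if_neg (by omega : ¬ n₁ = n₂)]
        simp [h1]
      rcases Nat.eq_zero_or_pos n₂ with h2 | h2
      · rw [if_neg (by omega : ¬ n₁ = n₂)]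
        simp [h2]
      rw [← Nat.mul_factorial_pred h1.ne', ← Nat.mul_factorial_pred h2.ne',
        if_congr (show n₁ - 1 = n₂ - 1 ↔ n₁ = n₂ by omega) rfl rfl]
      push_cast
      ring
    · intro I hI hI'
      rw [hzero I (mem_powersetCard.1 hI).2.ge, mul_zero]
      rintro a b rfl
      exact hI' (mem_image.2 ⟨(a, b), mem_univ _, rfl⟩)
  · rw [if_neg h2]
    refine Finset.sum_eq_zero fun I hI => ?_
    have hc := (mem_powersetCard.1 hI).2
    rcases hl.eq_or_lt with h1 | h1
    · obtain ⟨x, rfl⟩ := card_eq_one.1 (hc.trans h1.symm)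
      rw [det_deletePrincipal_compl_singleton, hM, hMij, if_neg (by cases x <;> simp), mul_zero]
    · rw [hzero I (by omega), mul_zero]
      rintro a b rfl
      rw [card_pair (by simp)] at hc
      exact h2 hc.symm

theorem hamCycleCount_completeBipartiteGraph [Field K] [CharZero K] {n₁ n₂ : ℕ}
    [DecidableRel (completeBipartiteGraph (Fin n₁) (Fin n₂)).Adj] (hn : 3 ≤ n₁ + n₂) :
    (hamCycleCount (completeBipartiteGraph (Fin n₁) (Fin n₂)) : K) =
      1 / ((n₁ : K) + (n₂ : K)) *
        ((n₁.factorial : K) * (n₂.factorial : K) * (if n₁ = n₂ then 1 else 0)) := by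
  rw [hamCycleCount_eq _ (fun _ => 0) (by simpa using hn), Fintype.card_sum, Fintype.card_fin,
    Fintype.card_fin, Finset.sum_eq_single_of_mem 2 (by rw [mem_Icc]; omega)]
  · rw [perDetCoeff_completeBipartiteGraph (by omega) (by norm_num), if_pos rfl]
    have : (n₁ : K) + (n₂ : K) ≠ 0 := by
      rw [← Nat.cast_add, Nat.cast_ne_zero]
      omega
    push_cast
    field_simp
  · intro l hl h2
    rw [perDetCoeff_completeBipartiteGraph (by omega) (mem_Icc.1 hl).1, if_neg h2, mul_zero]

end CompleteBipartiteGraph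

end HamiltonianEnumeration

theorem mainTheorem1 (K : Type u) [Field K] [CharZero K] :
    -- graphs
    (∀ (V : Type v) [Fintype V] [DecidableEq V] (G : SimpleGraph V) [DecidableRel G.Adj]
      (lam : V → K), 3 ≤ Fintype.card V →
      (HamiltonianEnumeration.hamCycleCount G : K) =
        1 / (2 * (Fintype.card V : K)) *
          ∑ l ∈ Finset.Icc 1 (Fintype.card V), (l : K) * (-1) ^ (l - 1) *
            HamiltonianEnumeration.perDetCoeff
              (HamiltonianEnumeration.paramMatrix (G.adjMatrix K) lam) l) ∧
    -- digraphs
    (∀ (V : Type v) [Fintype V] [DecidableEq V] (D : Digraph V) [DecidableRel D.Adj]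
      (lam : V → K), 2 ≤ Fintype.card V →
      (HamiltonianEnumeration.diHamCycleCount D : K) =
        1 / (Fintype.card V : K) *
          ∑ l ∈ Finset.Icc 1 (Fintype.card V), (l : K) * (-1) ^ (l - 1) *
            HamiltonianEnumeration.perDetCoeff
              (HamiltonianEnumeration.paramMatrix
                (HamiltonianEnumeration.diAdjMatrix K D) lam) l) ∧
    -- the complete graph on `n` vertices, with all parameters equal to 1
    (∀ n : ℕ, 3 ≤ n →
      (∀ l ∈ Finset.Icc 1 n,
        HamiltonianEnumeration.perDetCoeff
          (HamiltonianEnumeration.paramMatrix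
            ((⊤ : SimpleGraph (Fin n)).adjMatrix K) (fun _ => 1)) l =
          if l = 1 then (n.factorial : K) else 0) ∧
      (HamiltonianEnumeration.hamCycleCount (⊤ : SimpleGraph (Fin n)) : K) =
        1 / 2 * ((n - 1).factorial : K)) ∧
    -- the complete bipartite graph with parts of sizes `n₁` and `n₂`, with all parameters equal to 0
    (∀ (n₁ n₂ : ℕ) [DecidableRel (completeBipartiteGraph (Fin n₁) (Fin n₂)).Adj], 3 ≤ n₁ + n₂ →
      (∀ l ∈ Finset.Icc 1 (n₁ + n₂),
        HamiltonianEnumeration.perDetCoeff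
          (HamiltonianEnumeration.paramMatrix
            ((completeBipartiteGraph (Fin n₁) (Fin n₂)).adjMatrix K) (fun _ => 0)) l =
          if l = 2 then -((n₁.factorial : K) * (n₂.factorial : K) * (if n₁ = n₂ then 1 else 0))
          else 0) ∧
      (HamiltonianEnumeration.hamCycleCount (completeBipartiteGraph (Fin n₁) (Fin n₂)) : K) =
        1 / ((n₁ : K) + (n₂ : K)) *
          ((n₁.factorial : K) * (n₂.factorial : K) * (if n₁ = n₂ then 1 else 0))) := by
  open HamiltonianEnumeration in
  exact ⟨fun V _ _ G _ lam hV => hamCycleCount_eq G lam hV,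
    fun V _ _ D _ lam hV => diHamCycleCount_eq D lam hV,
    fun n hn => ⟨fun l hl => perDetCoeff_completeGraph (by omega) (Finset.mem_Icc.1 hl).1,
      hamCycleCount_completeGraph hn⟩,
    fun n₁ n₂ _ hn => ⟨fun l hl =>
      perDetCoeff_completeBipartiteGraph (by omega) (Finset.mem_Icc.1 hl).1,
      hamCycleCount_completeBipartiteGraph hn⟩⟩
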